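/- **Theorem (Definability).** A *modal symbol* is one of $\Box_+,\Box_-,\Diamond_+,\Diamond_-$. For a binary relation $R$ on a poset $(W,\leq)$ put (composing relations from left to right) $$\Box_+[R]={\leq}\circ R\circ{\leq},\quad \Box_-[R]={\leq}\circ R\circ{\geq},\quad \Diamond_+[R]={\geq}\circ R\circ{\geq},\quad \Diamond_-[R]={\geq}\circ R\circ{\leq},$$ and call $R$ a *$\Delta_\alpha$-relation* if $\Delta_\alpha[R]=R$. Let $\mathcal L$ be a set of modal symbols. An *$\mathcal L$-modal frame* is a poset $(W,\leq)$ with a $\Delta_\alpha$-relation $R^\Delta_\alpha$ for each $\Delta_\alpha\in\mathcal L$; it is *$\mathcal L$-unimodal* if there is a single binary relation $R$ on $W$ with $R^\Delta_\alpha=\Delta_\alpha[R]$ for all $\Delta_\alpha\in\mathcal L$. The *complex algebra* of an $\mathcal L$-modal frame is the bounded distributive lattice of all upsets of $(W,\leq)$ ordered by inclusion (equivalently, with its unique implication $\rightarrow$ and co-implication $-$, where $a\wedge b\leq c\iff b\leq a\rightarrow c$ and $a\leq b\vee c\iff a-b\leq c$, the bi-Heyting algebra of all upsets), equipped for each $\Delta_\alpha\in\mathcal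 L$ with the corresponding operator among $$\Box_+a=\{u: \forall v\,(uR^\Box_+v\Rightarrow v\in a)\},\qquad \Diamond_+a=\{u:\exists v\,(uR^\Diamond_+v \text{ and } v\in a)\},$$ $$\Box_-a=\{u: \forall v\,(uR^\Box_-v\Rightarrow v\notin a)\},\qquad \Diamond_-a=\{u:\exists v\,(uR^\Diamond_-v \text{ and } v\notin a)\}.$$ A class $\mathsf K$ of $\mathcal L$-modal frames is *definable* by sentences of a given kind if there is a set $T$ of sentences of that kind such that an $\mathcal L$-modal frame belongs to $\mathsf K$ if and only if its complex algebra satisfies all sentences in $T$. Let $\mathcal L_{\mathsf{DLat}}=\{\wedge,\vee,\top,\bot\}$ and $\mathcal L_{\mathsf{BiHA}}=\{\wedge,\vee,\top,\bot,\rightarrow,-\}$, and let $\mathsf{Fr}_{\mathcal L}$ be the class of all $\mathcal L$-unimodal frames. Then the following are equivalent: (i) $\mathsf{Fr}_{\mathcal L}$ is definable by quasiequations in $\mathcal L_{\mathsf{DLat}}\cup\mathcal L$; (ii) $\mathsf{Fr}_{\mathcal L}$ is definable by universal sentences in $\mathcal L_{\mathsf{DLat}}\cup\mathcal L$; (iii)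 $\mathsf{Fr}_{\mathcal L}$ is definable by equations in $\mathcal L_{\mathsf{BiHA}}\cup\mathcal L$; (iv) $\mathsf{Fr}_{\mathcal L}$ is definable by universal sentences in $\mathcal L_{\mathsf{BiHA}}\cup\mathcal L$; (v) $\mathcal L$ contains at most two modal symbols, $\mathcal L\neq\{\Box_+,\Diamond_+\}$ and $\mathcal L\neq\{\Box_-,\Diamond_-\}$. -/

import Mathlib

open FirstOrder

universe u

namespace Unimodal

/-! ### Modal symbols and monotone relations -/

/-- The two shapes of a modal symbol. -/
inductive Shape : Type
  | box
  | dia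

/-- A polarity is `+` or `-`. -/
inductive Polarity : Type
  | pos
  | neg

/-- The opposite polarity. -/
def Polarity.opp : Polarity → Polarity
  | .pos => .neg
  | .neg => .pos

/-- A modal symbol is a shape together with a polarity. -/
structure ModalSymbol : Type where
  shape : Shape
  pol : Polarity

/-- `□₊` -/
def boxPos : ModalSymbol := ⟨.box, .pos⟩

/-- `□₋` -/
def boxNeg : ModalSymbol := ⟨.box, .neg⟩

/-- `◇₊` -/
def diaPos : ModalSymbol := ⟨.dia, .pos⟩

/-- `◇₋` -/
def diaNeg : ModalSymbol := ⟨.dia, .neg⟩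

/-- The order of the poset `W^α`: the given order if `α = +`, its dual if `α = -`. -/
def polLE {W : Type u} [PartialOrder W] : Polarity → W → W → Prop
  | .pos, x, y => x ≤ y
  | .neg, x, y => y ≤ x

/-- The order of `W ×_{Δ_α} W`, which is `W⁻ × W^α` for `Δ = □` and `W × W^{-α}` for `Δ = ◇`:
`(u, v)` lies below `(u', v')`. -/
def prodLE {W : Type u} [PartialOrder W] (m : ModalSymbol) (u v u' v' : W) : Prop :=
  match m.shape with
  | .box => polLE .neg u u' ∧ polLE m.pol v v'
  | .dia => u ≤ u' ∧ polLE m.pol.opp v v'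

/-- `R` is a `Δ_α`-relation: an upset of `W ×_{Δ_α} W`. -/
def IsMonotoneRel {W : Type u} [PartialOrder W] (m : ModalSymbol) (R : W → W → Prop) : Prop :=
  ∀ u v u' v' : W, prodLE m u v u' v' → R u v → R u' v'

/-- `Δ_α[R]`, written as a composition of relations (read from left to right). -/
def gen {W : Type u} [PartialOrder W] : ModalSymbol → (W → W → Prop) → W → W → Prop
  | ⟨.box, .pos⟩, R => Relation.Comp (· ≤ ·) (Relation.Comp R (· ≤ ·))
  | ⟨.box, .neg⟩, R => Relation.Comp (· ≤ ·) (Relation.Comp R (· ≥ ·))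
  | ⟨.dia, .pos⟩, R => Relation.Comp (· ≥ ·) (Relation.Comp R (· ≥ ·))
  | ⟨.dia, .neg⟩, R => Relation.Comp (· ≥ ·) (Relation.Comp R (· ≤ ·))

theorem gen_iff {W : Type u} [PartialOrder W] (m : ModalSymbol) (R : W → W → Prop) (u v : W) :
    gen m R u v ↔ ∃ u' v', R u' v' ∧ prodLE m u' v' u v := by
  rcases m with ⟨_ | _, _ | _⟩ <;>
    simp only [gen, prodLE, polLE, Polarity.opp, Relation.Comp] <;>
    exact ⟨fun ⟨u', h, v', hR, h'⟩ => ⟨u', v', hR, h, h'⟩,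
      fun ⟨u', v', hR, h, h'⟩ => ⟨u', h, v', hR, h'⟩⟩

/-- `Δ_α[R]` is the least `Δ_α`-relation that extends `R`. -/
theorem gen_isLeast {W : Type u} [PartialOrder W] (m : ModalSymbol) (R : W → W → Prop) :
    IsLeast {S : W → W → Prop | IsMonotoneRel m S ∧ R ≤ S} (gen m R) := by
  refine ⟨⟨fun u v u' v' h hR => ?_, fun u v hR => ?_⟩, fun S hS u v hR => ?_⟩
  · rw [gen_iff] at hR ⊢
    obtain ⟨a, b, hab, h1⟩ := hR
    refine ⟨a, b, hab, ?_⟩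
    rcases m with ⟨_ | _, _ | _⟩ <;>
      simp only [prodLE, polLE, Polarity.opp] at h h1 ⊢ <;>
      exact ⟨by order, by order⟩
  · rw [gen_iff]
    refine ⟨u, v, hR, ?_⟩
    rcases m with ⟨_ | _, _ | _⟩ <;> simp [prodLE, polLE, Polarity.opp]
  · rw [gen_iff] at hR
    obtain ⟨a, b, hab, h1⟩ := hR
    exact hS.1 a b u v h1 (hS.2 a b hab)

/-! ### Modal frames -/

/-- An `L`-modal frame: a poset with a `Δ_α`-relation for each `Δ_α ∈ L`. -/
structure ModalFrame (L : Set ModalSymbol) : Type (u + 1) where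
  World : Type u
  [order : PartialOrder World]
  rel : L → World → World → Prop
  mono : ∀ m : L, IsMonotoneRel m.1 (rel m)

attribute [instance] ModalFrame.order

/-- The class of `L`-unimodal frames: all the relations are generated by a single relation. -/
def unimodalFrames (L : Set ModalSymbol) : Set (ModalFrame.{u} L) :=
  {F | ∃ R : F.World → F.World → Prop, ∀ m : L, F.rel m = gen m.1 R}

/-! ### The bi-Heyting algebra of upsets -/

/-- The upsets of a poset, ordered by inclusion. -/
abbrev Upset (W : Type u) [PartialOrder W] : Type u := {s : Set W // IsUpperSet s}

/-- The bi-Heyting algebra of upsets; `a ⇨ b` is the Heyting implication, `a \ b` is the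
co-implication. -/
instance Upset.instBiheytingAlgebra (W : Type u) [PartialOrder W] :
    BiheytingAlgebra (Upset W) where
  sup a b := ⟨a.1 ∪ b.1, a.2.union b.2⟩
  le_sup_left _ _ := Set.subset_union_left
  le_sup_right _ _ := Set.subset_union_right
  sup_le _ _ _ h h' := Set.union_subset h h'
  inf a b := ⟨a.1 ∩ b.1, a.2.inter b.2⟩
  inf_le_left _ _ := Set.inter_subset_left
  inf_le_right _ _ := Set.inter_subset_right
  le_inf _ _ _ h h' := Set.subset_inter h h'
  top := ⟨Set.univ, isUpperSet_univ⟩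
  le_top _ := Set.subset_univ _
  bot := ⟨∅, isUpperSet_empty⟩
  bot_le _ := Set.empty_subset _
  himp a b := ⟨{u | ∀ v, u ≤ v → v ∈ a.1 → v ∈ b.1},
    fun _ _ h hx v hv => hx v (h.trans hv)⟩
  le_himp_iff a b c :=
    ⟨fun h _ hx => h hx.1 _ le_rfl hx.2, fun h _ hx v hv hb => h ⟨a.2 hv hx, hb⟩⟩
  compl a := ⟨{u | ∀ v, u ≤ v → v ∈ a.1 → v ∈ (∅ : Set W)},
    fun _ _ h hx v hv => hx v (h.trans hv)⟩
  himp_bot _ := rfl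
  sdiff a b := ⟨{u | ∃ v, v ≤ u ∧ v ∈ a.1 ∧ v ∉ b.1},
    fun _ _ h ⟨v, hv, hab⟩ => ⟨v, hv.trans h, hab⟩⟩
  sdiff_le_iff a b c :=
    ⟨fun h x hx => by
      by_cases hb : x ∈ b.1
      · exact Or.inl hb
      · exact Or.inr (h ⟨x, le_rfl, hx, hb⟩),
     fun h x ⟨v, hv, ha, hb⟩ => c.2 hv ((h ha).resolve_left hb)⟩
  hnot a := ⟨{u | ∃ v, v ≤ u ∧ v ∈ (Set.univ : Set W) ∧ v ∉ a.1},
    fun _ _ h ⟨v, hv, hab⟩ => ⟨v, hv.trans h, hab⟩⟩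
  top_sdiff _ := rfl

/-- The set of worlds assigned to `Δ_α a` by the accessibility relation `R`. -/
def modalSet {W : Type u} : ModalSymbol → (W → W → Prop) → Set W → Set W
  | ⟨.box, .pos⟩, R, a => {u | ∀ v, R u v → v ∈ a}
  | ⟨.box, .neg⟩, R, a => {u | ∀ v, R u v → v ∉ a}
  | ⟨.dia, .pos⟩, R, a => {u | ∃ v, R u v ∧ v ∈ a}
  | ⟨.dia, .neg⟩, R, a => {u | ∃ v, R u v ∧ v ∉ a}

theorem modalSet_isUpperSet {W : Type u} [PartialOrder W] {m : ModalSymbol} {R : W → W → Prop}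
    (hR : IsMonotoneRel m R) (a : Set W) : IsUpperSet (modalSet m R a) := by
  intro x y hxy hx
  rcases m with ⟨_ | _, _ | _⟩
  · exact fun v hv => hx v (hR y v x v ⟨hxy, le_rfl⟩ hv)
  · exact fun v hv => hx v (hR y v x v ⟨hxy, le_rfl⟩ hv)
  · obtain ⟨v, hv, ha⟩ := hx
    exact ⟨v, hR x v y v ⟨hxy, le_rfl⟩ hv, ha⟩
  · obtain ⟨v, hv, ha⟩ := hx
    exact ⟨v, hR x v y v ⟨hxy, le_rfl⟩ hv, ha⟩

/-- The universe of the complex algebra of a modal frame. -/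
abbrev ModalFrame.Complex {L : Set ModalSymbol} (F : ModalFrame.{u} L) : Type u := Upset F.World

/-- The modal operators of the complex algebra. -/
def ModalFrame.op {L : Set ModalSymbol} (F : ModalFrame.{u} L) (m : L) (a : F.Complex) :
    F.Complex :=
  ⟨modalSet m.1 (F.rel m) a.1, modalSet_isUpperSet (F.mono m) a.1⟩

/-! ### Signatures -/

/-- Operation symbols of bounded distributive lattices. -/
inductive DLatFunc : ℕ → Type
  | inf : DLatFunc 2
  | sup : DLatFunc 2
  | top : DLatFunc 0
  | bot : DLatFunc 0

/-- Operation symbols of bi-Heyting algebras. -/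
inductive BiHAFunc : ℕ → Type
  | inf : BiHAFunc 2
  | sup : BiHAFunc 2
  | top : BiHAFunc 0
  | bot : BiHAFunc 0
  | himp : BiHAFunc 2
  | sdiff : BiHAFunc 2

/-- A unary operation symbol for each modal symbol in `L`. -/
inductive ModalFunc (L : Set ModalSymbol) : ℕ → Type
  | op (m : L) : ModalFunc L 1

/-- The signature of bounded distributive lattices. -/
def langDLat : FirstOrder.Language.{0, 0} := ⟨DLatFunc, fun _ => Empty⟩

/-- The signature of bi-Heyting algebras. -/
def langBiHA : FirstOrder.Language.{0, 0} := ⟨BiHAFunc, fun _ => Empty⟩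

/-- The signature of the modal operators in `L`. -/
def langModal (L : Set ModalSymbol) : FirstOrder.Language.{0, 0} := ⟨ModalFunc L, fun _ => Empty⟩

instance structDLat {L : Set ModalSymbol} (F : ModalFrame.{u} L) : langDLat.Structure F.Complex where
  funMap {_} f x :=
    match f, x with
    | DLatFunc.inf, x => x 0 ⊓ x 1
    | DLatFunc.sup, x => x 0 ⊔ x 1
    | DLatFunc.top, _ => ⊤
    | DLatFunc.bot, _ => ⊥
  RelMap {_} r := nomatch r

instance structBiHA {L : Set ModalSymbol} (F : ModalFrame.{u} L) : langBiHA.Structure F.Complex where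
  funMap {_} f x :=
    match f, x with
    | BiHAFunc.inf, x => x 0 ⊓ x 1
    | BiHAFunc.sup, x => x 0 ⊔ x 1
    | BiHAFunc.top, _ => ⊤
    | BiHAFunc.bot, _ => ⊥
    | BiHAFunc.himp, x => x 0 ⇨ x 1
    | BiHAFunc.sdiff, x => x 0 \ x 1
  RelMap {_} r := nomatch r

instance structModal {L : Set ModalSymbol} (F : ModalFrame.{u} L) :
    (langModal L).Structure F.Complex where
  funMap {_} f x :=
    match f, x with
    | ModalFunc.op m, x => F.op m (x 0)
  RelMap {_} r := nomatch r

/-! ### Equations, quasiequations and definability -/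

/-- `φ` is an equation: `∀ x₁ … xₙ, s = t`. -/
def IsEquation {S : FirstOrder.Language.{0, 0}} (φ : S.Sentence) : Prop :=
  ∃ (n : ℕ) (s t : S.Term (Empty ⊕ Fin n)), φ = (s.bdEqual t).alls

/-- The conjunction of a finite list of equations between terms. -/
def premises {S : FirstOrder.Language.{0, 0}} {n : ℕ} :
    List (S.Term (Empty ⊕ Fin n) × S.Term (Empty ⊕ Fin n)) → S.BoundedFormula Empty n
  | [] => ⊤
  | p :: l => p.1.bdEqual p.2 ⊓ premises l

/-- `φ` is a quasiequation: `∀ x₁ … xₙ, s₁ = t₁ ∧ … ∧ sₖ = tₖ → s = t` with `k ≥ 0`. -/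
def IsQuasiequation {S : FirstOrder.Language.{0, 0}} (φ : S.Sentence) : Prop :=
  ∃ (n : ℕ) (prem : List (S.Term (Empty ⊕ Fin n) × S.Term (Empty ⊕ Fin n)))
    (s t : S.Term (Empty ⊕ Fin n)),
    φ = ((premises prem).imp (s.bdEqual t)).alls

/-- `φ` is a universal sentence: a string of universal quantifiers before a quantifier-free
formula. -/
def IsUniversalSentence {S : FirstOrder.Language.{0, 0}} (φ : S.Sentence) : Prop :=
  FirstOrder.Language.BoundedFormula.IsUniversal φ

/-- The class `K` of `L`-modal frames is definable by sentences of the kind `P` in the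
signature `S`: some set `T` of such sentences holds in the complex algebra of a frame `F` if
and only if `F` belongs to `K`. -/
def IsDefinableBy {L : Set ModalSymbol} (S : FirstOrder.Language.{0, 0})
    [∀ F : ModalFrame.{u} L, S.Structure F.Complex]
    (P : S.Sentence → Prop) (K : Set (ModalFrame.{u} L)) : Prop :=
  ∃ T : S.Theory, (∀ φ ∈ T, P φ) ∧ ∀ F : ModalFrame.{u} L, F ∈ K ↔ F.Complex ⊨ T

end Unimodal

namespace Unimodal

/-! ### Sentences under language maps and embeddings -/

section Sentences

variable {S S' : FirstOrder.Language.{0, 0}}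

/-! A relation generating all the given relations is contained in their intersection, so a frame is
unimodal iff the intersection itself generates: every related pair lies, in the product order of its
symbol, above a pair common to all relations (`mem_unimodalFrames_iff`). Everything rests on how far
a complex algebra can see common pairs.

For two boxes or two diamonds, the first coordinate of a common pair can be moved to the world at
which the operators are evaluated, and upsets test the second coordinate; two lattice inequalities
result. For `□_α` and `◇_{-α}`, it is the second coordinate that both relations close in the same
direction, so it can be fixed at `v`. What remains compares the downset and the upset of worlds
related to `v` by the two relations, and is expressed by two quasiequations, or by equations once
residuation absorbs the extra variable.

For `□₊, ◇₊` the coordinates cannot be aligned in this way. On the rational chain take `<` for `□₊`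
and `>` for `◇₊`: no pair is common, so the frame is not unimodal. Now replace each `x` by `x⁻ < x <
x⁺` and let the identity on the new points generate the relations. Upsets extend to the new chain by
one-sided limits: `x⁻` belongs if some point below `x` does, `x⁺` if all points above `x` do. This
embeds the complex algebra of the first frame in that of a unimodal one (`splitEmbedding`), and
universal sentences pass to substructures. Symbols of the other polarity get the total relation, so
the embedding exists for every `L`. The pair `□₋, ◇₋` is treated by reflecting the second
coordinate. -/

theorem isUniversal_alls {n : ℕ} {φ : S.BoundedFormula Empty n} (h : φ.IsUniversal) :
    FirstOrder.Language.BoundedFormula.IsUniversal φ.alls := by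
  induction n with
  | zero => exact h
  | succ n ih => exact ih h.all

theorem isQF_premises {n : ℕ} (l : List (S.Term (Empty ⊕ Fin n) × S.Term (Empty ⊕ Fin n))) :
    (premises l).IsQF := by
  induction l with
  | nil => exact FirstOrder.Language.BoundedFormula.IsQF.top
  | cons p l ih =>
    exact (FirstOrder.Language.BoundedFormula.IsAtomic.equal p.1 p.2).isQF.inf ih

theorem IsQuasiequation.isUniversalSentence {φ : S.Sentence} (h : IsQuasiequation φ) :
    IsUniversalSentence φ := by
  obtain ⟨n, prem, s, t, rfl⟩ := h
  exact isUniversal_alls ((isQF_premises prem).imp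
    (FirstOrder.Language.BoundedFormula.IsAtomic.equal s t).isQF).isUniversal

theorem IsEquation.isUniversalSentence {φ : S.Sentence} (h : IsEquation φ) :
    IsUniversalSentence φ := by
  obtain ⟨n, s, t, rfl⟩ := h
  exact isUniversal_alls (FirstOrder.Language.BoundedFormula.IsAtomic.equal s t).isUniversal

theorem isQF_onBoundedFormula (g : S →ᴸ S') {α : Type} {n : ℕ} {φ : S.BoundedFormula α n}
    (h : φ.IsQF) : (g.onBoundedFormula φ).IsQF := by
  induction h with
  | falsum => exact FirstOrder.Language.BoundedFormula.IsQF.falsum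
  | of_isAtomic h =>
    cases h with
    | equal t₁ t₂ => exact (FirstOrder.Language.BoundedFormula.IsAtomic.equal _ _).isQF
    | rel R ts => exact (FirstOrder.Language.BoundedFormula.IsAtomic.rel _ _).isQF
  | imp _ _ ih₁ ih₂ => exact ih₁.imp ih₂

theorem isUniversal_onBoundedFormula (g : S →ᴸ S') {α : Type} {n : ℕ}
    {φ : S.BoundedFormula α n} (h : φ.IsUniversal) : (g.onBoundedFormula φ).IsUniversal := by
  induction h with
  | of_isQF h => exact (isQF_onBoundedFormula g h).isUniversal
  | all _ ih => exact ih.all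

theorem onBoundedFormula_alls (g : S →ᴸ S') {n : ℕ} (φ : S.BoundedFormula Empty n) :
    g.onSentence φ.alls = (g.onBoundedFormula φ).alls := by
  induction n with
  | zero => rfl
  | succ n ih => exact ih φ.all

theorem IsEquation.onSentence (g : S →ᴸ S') {φ : S.Sentence} (h : IsEquation φ) :
    IsEquation (g.onSentence φ) := by
  obtain ⟨n, s, t, rfl⟩ := h
  exact ⟨n, g.onTerm s, g.onTerm t, onBoundedFormula_alls g _⟩

variable {M : Type*} [S.Structure M]

theorem realize_premises {n : ℕ} (l : List (S.Term (Empty ⊕ Fin n) × S.Term (Empty ⊕ Fin n)))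
    (v : Empty → M) (x : Fin n → M) :
    (premises l).Realize v x ↔
      ∀ p ∈ l, p.1.realize (Sum.elim v x) = p.2.realize (Sum.elim v x) := by
  induction l with
  | nil => simp [premises]
  | cons p l ih => simp [premises, ih]

/-- The equation `s = t` as a sentence. -/
def eqn {n : ℕ} (s t : S.Term (Empty ⊕ Fin n)) : S.Sentence := (s.bdEqual t).alls

/-- The quasiequation `s' = t' → s = t` as a sentence. -/
def quasieqn {n : ℕ} (s' t' s t : S.Term (Empty ⊕ Fin n)) : S.Sentence :=
  ((premises [(s', t')]).imp (s.bdEqual t)).alls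

theorem isEquation_eqn {n : ℕ} (s t : S.Term (Empty ⊕ Fin n)) : IsEquation (eqn s t) :=
  ⟨n, s, t, rfl⟩

theorem isQuasiequation_quasieqn {n : ℕ} (s' t' s t : S.Term (Empty ⊕ Fin n)) :
    IsQuasiequation (quasieqn s' t' s t) := ⟨n, _, s, t, rfl⟩

theorem realize_eqn {n : ℕ} (s t : S.Term (Empty ⊕ Fin n)) :
    M ⊨ eqn s t ↔ ∀ x : Fin n → M,
      s.realize (Sum.elim default x) = t.realize (Sum.elim default x) := by
  refine FirstOrder.Language.BoundedFormula.realize_alls.trans ?_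
  simp only [FirstOrder.Language.BoundedFormula.realize_bdEqual]

theorem realize_quasieqn {n : ℕ} (s' t' s t : S.Term (Empty ⊕ Fin n)) :
    M ⊨ quasieqn s' t' s t ↔ ∀ x : Fin n → M,
      s'.realize (Sum.elim default x) = t'.realize (Sum.elim default x) →
      s.realize (Sum.elim default x) = t.realize (Sum.elim default x) := by
  refine FirstOrder.Language.BoundedFormula.realize_alls.trans ?_
  simp [realize_premises]

/-- A quasiequation is by form an implication, so an equation has to be given a trivially true
premise; `s = s` serves. -/
theorem IsEquation.exists_quasiequation {φ : S.Sentence} (h : IsEquation φ) :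
    ∃ ψ : S.Sentence, IsQuasiequation ψ ∧
      ∀ (M : Type u) [S.Structure M], M ⊨ ψ ↔ M ⊨ φ := by
  obtain ⟨n, s, t, rfl⟩ := h
  refine ⟨quasieqn s s s t, isQuasiequation_quasieqn _ _ _ _, fun M _ => ?_⟩
  exact (realize_quasieqn s s s t).trans
    ((forall_congr' fun x => by simp).trans (realize_eqn s t).symm)

end Sentences

/-! ### Definability -/

section Definability

variable {L : Set ModalSymbol} {S S' : FirstOrder.Language.{0, 0}}
  [∀ F : ModalFrame.{u} L, S.Structure F.Complex]
  [∀ F : ModalFrame.{u} L, S'.Structure F.Complex] {K : Set (ModalFrame.{u} L)}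

theorem IsDefinableBy.mono {P Q : S.Sentence → Prop} (hPQ : ∀ φ, P φ → Q φ)
    (h : IsDefinableBy S P K) : IsDefinableBy S Q K := by
  obtain ⟨T, hT, h⟩ := h
  exact ⟨T, fun φ hφ => hPQ φ (hT φ hφ), h⟩

theorem IsDefinableBy.of_lhom (g : S →ᴸ S') [∀ F : ModalFrame.{u} L, g.IsExpansionOn F.Complex]
    {P : S.Sentence → Prop} {Q : S'.Sentence → Prop} (hPQ : ∀ φ, P φ → Q (g.onSentence φ))
    (h : IsDefinableBy S P K) : IsDefinableBy S' Q K := by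
  obtain ⟨T, hT, h⟩ := h
  refine ⟨g.onTheory T, ?_, fun F => ?_⟩
  · rintro _ ⟨φ, hφ, rfl⟩
    exact hPQ φ (hT φ hφ)
  · rw [h F, FirstOrder.Language.LHom.onTheory_model]

theorem IsDefinableBy.quasiequation_of_equation (h : IsDefinableBy S IsEquation K) :
    IsDefinableBy S IsQuasiequation K := by
  obtain ⟨T, hT, h⟩ := h
  choose! q hq hq' using fun φ (hφ : φ ∈ T) => (hT φ hφ).exists_quasiequation
  refine ⟨q '' T, ?_, fun F => ?_⟩
  · rintro _ ⟨φ, hφ, rfl⟩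
    exact hq φ hφ
  · rw [h F, FirstOrder.Language.Theory.model_iff, FirstOrder.Language.Theory.model_iff,
      Set.forall_mem_image]
    exact forall₂_congr fun φ hφ => (hq' φ hφ F.Complex).symm

theorem isDefinableBy_pair {P : S.Sentence → Prop} {φ ψ : S.Sentence} (hφ : P φ) (hψ : P ψ)
    (h : ∀ F : ModalFrame.{u} L, F ∈ K ↔ F.Complex ⊨ φ ∧ F.Complex ⊨ ψ) :
    IsDefinableBy S P K :=
  ⟨{φ, ψ}, by rintro _ (rfl | rfl) <;> assumption, fun F => by
    rw [h F, FirstOrder.Language.Theory.model_iff]; simp⟩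

theorem isDefinableBy_of_forall_mem {P : S.Sentence → Prop} (h : ∀ F, F ∈ K) :
    IsDefinableBy S P K :=
  ⟨∅, by simp, fun F => by simp [h F]⟩

/-- Universal sentences are preserved under embeddings of complex algebras. -/
theorem not_isDefinableBy_of_embedding {F G : ModalFrame.{u} L} (hF : F ∉ K) (hG : G ∈ K)
    (e : F.Complex ↪[S] G.Complex) : ¬ IsDefinableBy S IsUniversalSentence K := by
  rintro ⟨T, hT, h⟩
  have : T.IsUniversal := ⟨fun φ hφ => hT φ hφ⟩
  have := (h G).1 hG
  exact hF ((h F).2 (FirstOrder.Language.Theory.IsUniversal.models_of_embedding e))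

end Definability

/-! ### Lattice terms are bi-Heyting terms -/

/-- The inclusion of the signature of bounded lattices in that of bi-Heyting algebras. -/
def dlatToBiHA : langDLat →ᴸ langBiHA where
  onFunction {_} f :=
    match f with
    | DLatFunc.inf => BiHAFunc.inf
    | DLatFunc.sup => BiHAFunc.sup
    | DLatFunc.top => BiHAFunc.top
    | DLatFunc.bot => BiHAFunc.bot
  onRelation {_} r := nomatch r

instance {L : Set ModalSymbol} (F : ModalFrame.{u} L) : dlatToBiHA.IsExpansionOn F.Complex where
  map_onFunction {_} f x := by cases f <;> rfl
  map_onRelation {_} r := nomatch r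

/-- The inclusion of the modal lattice signature in the modal bi-Heyting signature. -/
def modalDLatToBiHA (L : Set ModalSymbol) :
    langDLat.sum (langModal L) →ᴸ langBiHA.sum (langModal L) :=
  dlatToBiHA.sumMap (FirstOrder.Language.LHom.id _)

instance {L : Set ModalSymbol} (F : ModalFrame.{u} L) :
    (modalDLatToBiHA L).IsExpansionOn F.Complex :=
  inferInstanceAs ((dlatToBiHA.sumMap (FirstOrder.Language.LHom.id _)).IsExpansionOn F.Complex)

theorem IsDefinableBy.universal_biHA {L : Set ModalSymbol} {K : Set (ModalFrame.{u} L)}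
    (h : IsDefinableBy (langDLat.sum (langModal L)) IsUniversalSentence K) :
    IsDefinableBy (langBiHA.sum (langModal L)) IsUniversalSentence K :=
  h.of_lhom (modalDLatToBiHA L) fun _ hφ => isUniversal_onBoundedFormula _ hφ

theorem IsDefinableBy.equation_biHA {L : Set ModalSymbol} {K : Set (ModalFrame.{u} L)}
    (h : IsDefinableBy (langDLat.sum (langModal L)) IsEquation K) :
    IsDefinableBy (langBiHA.sum (langModal L)) IsEquation K :=
  h.of_lhom (modalDLatToBiHA L) fun _ hφ => hφ.onSentence _

/-! ### Terms -/

section Terms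

variable {L : Set ModalSymbol} {n : ℕ}

/-- Terms in the signature of bounded lattices with modal operators. -/
abbrev DTerm (L : Set ModalSymbol) (n : ℕ) : Type :=
  (langDLat.sum (langModal L)).Term (Empty ⊕ Fin n)

/-- Terms in the signature of bi-Heyting algebras with modal operators. -/
abbrev BTerm (L : Set ModalSymbol) (n : ℕ) : Type :=
  (langBiHA.sum (langModal L)).Term (Empty ⊕ Fin n)

/-- The term `s ⊓ t`. -/
def DTerm.inf (s t : DTerm L n) : DTerm L n := .func (l := 2) (Sum.inl DLatFunc.inf) ![s, t]

/-- The term `s ⊔ t`. -/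
def DTerm.sup (s t : DTerm L n) : DTerm L n := .func (l := 2) (Sum.inl DLatFunc.sup) ![s, t]

/-- The term `Δ t`. -/
def DTerm.op (m : L) (t : DTerm L n) : DTerm L n := .func (l := 1) (Sum.inr (ModalFunc.op m)) ![t]

/-- The `i`-th variable. -/
def DTerm.var (i : Fin n) : DTerm L n :=
  FirstOrder.Language.Term.var (Sum.inr i)

/-- The term `s ⇨ t`. -/
def BTerm.himp (s t : BTerm L n) : BTerm L n := .func (l := 2) (Sum.inl BiHAFunc.himp) ![s, t]

/-- The term `s \ t`. -/
def BTerm.sdiff (s t : BTerm L n) : BTerm L n := .func (l := 2) (Sum.inl BiHAFunc.sdiff) ![s, t]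

/-- The term `Δ t`. -/
def BTerm.op (m : L) (t : BTerm L n) : BTerm L n := .func (l := 1) (Sum.inr (ModalFunc.op m)) ![t]

/-- The `i`-th variable. -/
def BTerm.var (i : Fin n) : BTerm L n :=
  FirstOrder.Language.Term.var (Sum.inr i)

variable {F : ModalFrame.{u} L} {v : Empty ⊕ Fin n → F.Complex}

theorem DTerm.realize_inf (s t : DTerm L n) :
    (s.inf t).realize v = s.realize v ⊓ t.realize v := rfl

/-- The equation expressing `s ≤ t`. -/
def leqn (s t : DTerm L n) : (langDLat.sum (langModal L)).Sentence := eqn (s.inf t) s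

theorem realize_leqn (s t : DTerm L n) : F.Complex ⊨ leqn s t ↔ ∀ x : Fin n → F.Complex,
    s.realize (Sum.elim default x) ≤ t.realize (Sum.elim default x) := by
  refine (realize_eqn _ _).trans (forall_congr' fun x => ?_)
  rw [DTerm.realize_inf, inf_eq_left]

/-- The quasiequation expressing that `s' ≤ t'` implies `s ≤ t`. -/
def qleqn (s' t' s t : DTerm L n) : (langDLat.sum (langModal L)).Sentence :=
  quasieqn (s'.inf t') s' (s.inf t) s

theorem realize_qleqn (s' t' s t : DTerm L n) : F.Complex ⊨ qleqn s' t' s t ↔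
    ∀ x : Fin n → F.Complex,
    s'.realize (Sum.elim default x) ≤ t'.realize (Sum.elim default x) →
    s.realize (Sum.elim default x) ≤ t.realize (Sum.elim default x) := by
  refine (realize_quasieqn _ _ _ _).trans (forall_congr' fun x => ?_)
  rw [DTerm.realize_inf, inf_eq_left, DTerm.realize_inf, inf_eq_left]

end Terms

theorem forall_fin_two_fun {α : Type*} {p : α → α → Prop} :
    (∀ x : Fin 2 → α, p (x 0) (x 1)) ↔ ∀ a b, p a b :=
  ⟨fun h a b => h ![a, b], fun h _ => h _ _⟩

/-! ### Unimodal frames in a signature with at most two modal symbols -/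

theorem prodLE_refl {W : Type u} [PartialOrder W] (m : ModalSymbol) (u v : W) :
    prodLE m u v u v := by
  rcases m with ⟨_ | _, _ | _⟩ <;> exact ⟨le_rfl, le_rfl⟩

theorem gen_le_rel {L : Set ModalSymbol} (F : ModalFrame.{u} L) {R : F.World → F.World → Prop}
    (m : L) (h : ∀ u v, R u v → F.rel m u v) {u v : F.World} (huv : gen m.1 R u v) :
    F.rel m u v :=
  (gen_isLeast m.1 R).2 ⟨F.mono m, h⟩ u v huv

/-- The intersection of the relations is the largest possible generator. What it generates is always
contained in each relation, so only the reverse inclusion is a condition. -/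
theorem mem_unimodalFrames_iff {L : Set ModalSymbol} {F : ModalFrame.{u} L} :
    F ∈ unimodalFrames L ↔ ∀ (m : L) (u v : F.World), F.rel m u v →
      ∃ u' v', (∀ m' : L, F.rel m' u' v') ∧ prodLE m.1 u' v' u v := by
  constructor
  · rintro ⟨R, hR⟩ m u v huv
    rw [hR m, gen_iff] at huv
    obtain ⟨u', v', h, hle⟩ := huv
    exact ⟨u', v', fun m' => hR m' ▸ (gen_isLeast m'.1 R).1.2 u' v' h, hle⟩
  · intro h
    refine ⟨fun u v => ∀ m' : L, F.rel m' u v, fun m => ?_⟩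
    ext u v
    refine ⟨fun huv => (gen_iff _ _ _ _).2 (h m u v huv), gen_le_rel F m fun u v h => h m⟩

theorem mem_unimodalFrames_of_subsingleton {L : Set ModalSymbol} (hL : L.Subsingleton)
    (F : ModalFrame.{u} L) : F ∈ unimodalFrames L :=
  mem_unimodalFrames_iff.2 fun m u v huv =>
    ⟨u, v, fun m' => (Subtype.ext (hL m'.2 m.2) : m' = m) ▸ huv, prodLE_refl _ _ _⟩

theorem mem_unimodalFrames_pair_iff {L : Set ModalSymbol} {F : ModalFrame.{u} L} {m₁ m₂ : L}
    (hL : ∀ m : L, m = m₁ ∨ m = m₂) :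
    F ∈ unimodalFrames L ↔
      (∀ u v : F.World, F.rel m₁ u v →
        ∃ u' v', (F.rel m₁ u' v' ∧ F.rel m₂ u' v') ∧ prodLE m₁.1 u' v' u v) ∧
      (∀ u v : F.World, F.rel m₂ u v →
        ∃ u' v', (F.rel m₁ u' v' ∧ F.rel m₂ u' v') ∧ prodLE m₂.1 u' v' u v) := by
  have key : ∀ u v, (∀ m : L, F.rel m u v) ↔ F.rel m₁ u v ∧ F.rel m₂ u v := fun u v =>
    ⟨fun h => ⟨h _, h _⟩, fun h m => by rcases hL m with rfl | rfl; exacts [h.1, h.2]⟩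
  rw [mem_unimodalFrames_iff]
  simp only [key]
  exact ⟨fun h => ⟨h _, h _⟩, fun h m => by rcases hL m with rfl | rfl; exacts [h.1, h.2]⟩

/-! ### Two modal symbols of the same shape -/

section SameShape

variable {L : Set ModalSymbol} (hp : boxPos ∈ L) (hn : boxNeg ∈ L)
  (dp : diaPos ∈ L) (dn : diaNeg ∈ L) (F : ModalFrame.{u} L)

/-- Both box relations are closed downwards in the first coordinate, so a common pair `(u', v')`
with `u ≤ u'` can be replaced by `(u, v')`. For each `u` only the two sets of successors matter. -/
theorem mem_unimodalFrames_box_iff (hL : ∀ m : L, m = ⟨boxPos, hp⟩ ∨ m = ⟨boxNeg, hn⟩) :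
    F ∈ unimodalFrames L ↔
      (∀ a b : F.Complex, F.op ⟨boxPos, hp⟩ (a ⊔ b) ⊓ F.op ⟨boxNeg, hn⟩ b ≤ F.op ⟨boxPos, hp⟩ a) ∧
      (∀ a b : F.Complex,
        F.op ⟨boxPos, hp⟩ a ⊓ F.op ⟨boxNeg, hn⟩ (a ⊓ b) ≤ F.op ⟨boxNeg, hn⟩ b) := by
  rw [mem_unimodalFrames_pair_iff hL]
  constructor
  · rintro ⟨h₁, h₂⟩
    refine ⟨fun a b u hu v huv => ?_, fun a b u hu v huv hb => ?_⟩
    · obtain ⟨u', v', ⟨h, h'⟩, hle, hle'⟩ := h₁ u v huv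
      refine a.2 hle' ((hu.1 v' (F.mono ⟨boxPos, hp⟩ u' v' u v' ⟨hle, le_rfl⟩ h)).resolve_right ?_)
      exact hu.2 v' (F.mono ⟨boxNeg, hn⟩ u' v' u v' ⟨hle, le_rfl⟩ h')
    · obtain ⟨u', v', ⟨h, h'⟩, hle, hle'⟩ := h₂ u v huv
      exact hu.2 v' (F.mono ⟨boxNeg, hn⟩ u' v' u v' ⟨hle, le_rfl⟩ h')
        ⟨hu.1 v' (F.mono ⟨boxPos, hp⟩ u' v' u v' ⟨hle, le_rfl⟩ h), b.2 hle' hb⟩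
  · rintro ⟨h₁, h₂⟩
    refine ⟨fun u v huv => ?_, fun u v huv => ?_⟩
    -- Here `a` is the upset generated by the common successors of `u`, and `b` consists of the
    -- non-successors for `□₋`. Then `u` satisfies the left side, and `v ∈ a` is the required
    -- witness.
    · let a : F.Complex := ⟨{w | ∃ v', (F.rel ⟨boxPos, hp⟩ u v' ∧ F.rel ⟨boxNeg, hn⟩ u v') ∧ v' ≤ w},
        fun _ _ hw ⟨v', h, hle⟩ => ⟨v', h, hle.trans hw⟩⟩
      let b : F.Complex := ⟨{w | ¬ F.rel ⟨boxNeg, hn⟩ u w},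
        fun _ _ hw h h' => h (F.mono ⟨boxNeg, hn⟩ _ _ _ _ ⟨le_rfl, hw⟩ h')⟩
      have hu : u ∈ (F.op ⟨boxPos, hp⟩ (a ⊔ b) ⊓ F.op ⟨boxNeg, hn⟩ b).1 := by
        refine ⟨fun w hw => ?_, fun w hw hb => hb hw⟩
        by_cases hw' : F.rel ⟨boxNeg, hn⟩ u w
        · exact Or.inl ⟨w, ⟨hw, hw'⟩, le_rfl⟩
        · exact Or.inr hw'
      obtain ⟨v', h, hle⟩ := h₁ a b hu v huv
      exact ⟨u, v', h, le_rfl, hle⟩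
    -- Here `b` is the largest upset disjoint from the common successors of `u`, so `v ∉ b` means
    -- that `v` lies below one of them.
    · let a : F.Complex := ⟨{w | F.rel ⟨boxPos, hp⟩ u w},
        fun _ _ hw h => F.mono ⟨boxPos, hp⟩ _ _ _ _ ⟨le_rfl, hw⟩ h⟩
      let b : F.Complex := ⟨{w | ¬ ∃ v', (F.rel ⟨boxPos, hp⟩ u v' ∧ F.rel ⟨boxNeg, hn⟩ u v') ∧ w ≤ v'},
        fun _ _ hw h ⟨v', h', hle⟩ => h ⟨v', h', hw.trans hle⟩⟩
      have hu : u ∈ (F.op ⟨boxPos, hp⟩ a ⊓ F.op ⟨boxNeg, hn⟩ (a ⊓ b)).1 :=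
        ⟨fun w hw => hw, fun w hw hab => hab.2 ⟨w, ⟨hab.1, hw⟩, le_rfl⟩⟩
      obtain ⟨v', h, hle⟩ := not_not.1 (h₂ a b hu v huv)
      exact ⟨u, v', h, le_rfl, hle⟩

/-- The diamond relations are closed upwards in the first coordinate, so again a common pair can be
moved to `u`. The test upsets are chosen as for boxes, with the two inequalities in exchanged roles.
-/
theorem mem_unimodalFrames_dia_iff (hL : ∀ m : L, m = ⟨diaPos, dp⟩ ∨ m = ⟨diaNeg, dn⟩) :
    F ∈ unimodalFrames L ↔
      (∀ a b : F.Complex, F.op ⟨diaPos, dp⟩ b ≤ F.op ⟨diaNeg, dn⟩ a ⊔ F.op ⟨diaPos, dp⟩ (a ⊓ b)) ∧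
      (∀ a b : F.Complex,
        F.op ⟨diaNeg, dn⟩ a ≤ F.op ⟨diaNeg, dn⟩ (a ⊔ b) ⊔ F.op ⟨diaPos, dp⟩ b) := by
  rw [mem_unimodalFrames_pair_iff hL]
  constructor
  · rintro ⟨h₁, h₂⟩
    refine ⟨fun a b u hu => ?_, fun a b u hu => ?_⟩
    · obtain ⟨v, huv, hb⟩ := hu
      obtain ⟨u', v', ⟨h, h'⟩, hle, hle'⟩ := h₁ u v huv
      by_cases ha : v' ∈ a.1
      · exact Or.inr ⟨v', F.mono ⟨diaPos, dp⟩ u' v' u v' ⟨hle, le_rfl⟩ h, ha, b.2 hle' hb⟩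
      · exact Or.inl ⟨v', F.mono ⟨diaNeg, dn⟩ u' v' u v' ⟨hle, le_rfl⟩ h', ha⟩
    · obtain ⟨v, huv, ha⟩ := hu
      obtain ⟨u', v', ⟨h, h'⟩, hle, hle'⟩ := h₂ u v huv
      by_cases hb : v' ∈ b.1
      · exact Or.inr ⟨v', F.mono ⟨diaPos, dp⟩ u' v' u v' ⟨hle, le_rfl⟩ h, hb⟩
      · exact Or.inl ⟨v', F.mono ⟨diaNeg, dn⟩ u' v' u v' ⟨hle, le_rfl⟩ h',
          fun hab => hab.elim (fun h => ha (a.2 hle' h)) hb⟩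
  · rintro ⟨h₁, h₂⟩
    refine ⟨fun u v huv => ?_, fun u v huv => ?_⟩
    · let a : F.Complex := ⟨{w | F.rel ⟨diaNeg, dn⟩ u w},
        fun _ _ hw h => F.mono ⟨diaNeg, dn⟩ _ _ _ _ ⟨le_rfl, hw⟩ h⟩
      let b : F.Complex := ⟨{w | ¬ ∃ v', (F.rel ⟨diaPos, dp⟩ u v' ∧ F.rel ⟨diaNeg, dn⟩ u v') ∧ w ≤ v'},
        fun _ _ hw h ⟨v', h', hle⟩ => h ⟨v', h', hw.trans hle⟩⟩
      by_contra hcon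
      have hu : u ∈ (F.op ⟨diaPos, dp⟩ b).1 :=
        ⟨v, huv, fun ⟨v', h, hle⟩ => hcon ⟨u, v', h, le_rfl, hle⟩⟩
      rcases h₁ a b hu with ⟨w, hw, ha⟩ | ⟨w, hw, ha, hb⟩
      · exact ha hw
      · exact hb ⟨w, ⟨hw, ha⟩, le_rfl⟩
    · let a : F.Complex := ⟨{w | ∃ v', (F.rel ⟨diaPos, dp⟩ u v' ∧ F.rel ⟨diaNeg, dn⟩ u v') ∧ v' ≤ w},
        fun _ _ hw ⟨v', h, hle⟩ => ⟨v', h, hle.trans hw⟩⟩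
      let b : F.Complex := ⟨{w | ¬ F.rel ⟨diaPos, dp⟩ u w},
        fun _ _ hw h h' => h (F.mono ⟨diaPos, dp⟩ _ _ _ _ ⟨le_rfl, hw⟩ h')⟩
      by_contra hcon
      have hu : u ∈ (F.op ⟨diaNeg, dn⟩ a).1 :=
        ⟨v, huv, fun ⟨v', h, hle⟩ => hcon ⟨u, v', h, le_rfl, hle⟩⟩
      rcases h₂ a b hu with ⟨w, hw, hab⟩ | ⟨w, hw, hb⟩
      · by_cases hw' : F.rel ⟨diaPos, dp⟩ u w
        · exact hab (Or.inl ⟨w, ⟨hw', hw⟩, le_rfl⟩)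
        · exact hab (Or.inr hw')
      · exact hb hw

theorem isDefinableBy_equation_box (hL : ∀ m : L, m = ⟨boxPos, hp⟩ ∨ m = ⟨boxNeg, hn⟩) :
    IsDefinableBy (langDLat.sum (langModal L)) IsEquation (unimodalFrames.{u} L) := by
  let a : DTerm L 2 := DTerm.var 0
  let b : DTerm L 2 := DTerm.var 1
  refine isDefinableBy_pair
    (φ := leqn (DTerm.inf (DTerm.op ⟨boxPos, hp⟩ (a.sup b)) (DTerm.op ⟨boxNeg, hn⟩ b))
      (DTerm.op ⟨boxPos, hp⟩ a))
    (ψ := leqn (DTerm.inf (DTerm.op ⟨boxPos, hp⟩ a) (DTerm.op ⟨boxNeg, hn⟩ (a.inf b)))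
      (DTerm.op ⟨boxNeg, hn⟩ b)) (isEquation_eqn _ _) (isEquation_eqn _ _) fun F => ?_
  rw [mem_unimodalFrames_box_iff hp hn F hL, realize_leqn, realize_leqn]
  exact and_congr forall_fin_two_fun.symm forall_fin_two_fun.symm

theorem isDefinableBy_equation_dia (hL : ∀ m : L, m = ⟨diaPos, dp⟩ ∨ m = ⟨diaNeg, dn⟩) :
    IsDefinableBy (langDLat.sum (langModal L)) IsEquation (unimodalFrames.{u} L) := by
  let a : DTerm L 2 := DTerm.var 0
  let b : DTerm L 2 := DTerm.var 1
  refine isDefinableBy_pair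
    (φ := leqn (DTerm.op ⟨diaPos, dp⟩ b)
      (DTerm.sup (DTerm.op ⟨diaNeg, dn⟩ a) (DTerm.op ⟨diaPos, dp⟩ (a.inf b))))
    (ψ := leqn (DTerm.op ⟨diaNeg, dn⟩ a)
      (DTerm.sup (DTerm.op ⟨diaNeg, dn⟩ (a.sup b)) (DTerm.op ⟨diaPos, dp⟩ b)))
    (isEquation_eqn _ _) (isEquation_eqn _ _) fun F => ?_
  rw [mem_unimodalFrames_dia_iff dp dn F hL, realize_leqn, realize_leqn]
  exact and_congr forall_fin_two_fun.symm forall_fin_two_fun.symm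

end SameShape

/-! ### Two modal symbols of different shape and opposite polarity -/

section OppositePolarity

variable {L : Set ModalSymbol} {α : Polarity} (hb : ⟨.box, α⟩ ∈ L) (hd : ⟨.dia, α.opp⟩ ∈ L)
  (F : ModalFrame.{u} L)

/-- Each world `v` has an upset `a` that turns `□` and `◇` into the inverse images of `v`. -/
theorem exists_upset_preimage (v : F.World) : ∃ a : F.Complex,
    (∀ u, u ∈ (F.op ⟨_, hb⟩ a).1 ↔ ¬ F.rel ⟨_, hb⟩ u v) ∧
    (∀ u, u ∈ (F.op ⟨_, hd⟩ a).1 ↔ F.rel ⟨_, hd⟩ u v) := by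
  cases α with
  | pos =>
    refine ⟨⟨{w | ¬ w ≤ v}, fun _ _ h hw h' => hw (h.trans h')⟩, fun u => ?_, fun u => ?_⟩
    · exact ⟨fun h h' => h v h' le_rfl, fun h w hw hle => h (F.mono ⟨_, hb⟩ _ _ _ _ ⟨le_rfl, hle⟩ hw)⟩
    · exact ⟨fun ⟨w, hw, hle⟩ => F.mono ⟨_, hd⟩ _ _ _ _ ⟨le_rfl, not_not.1 hle⟩ hw,
        fun h => ⟨v, h, not_not.2 le_rfl⟩⟩
  | neg =>
    refine ⟨⟨{w | v ≤ w}, fun _ _ h hw => hw.trans h⟩, fun u => ?_, fun u => ?_⟩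
    · exact ⟨fun h h' => h v h' le_rfl, fun h w hw hle => h (F.mono ⟨_, hb⟩ _ _ _ _ ⟨le_rfl, hle⟩ hw)⟩
    · exact ⟨fun ⟨w, hw, hle⟩ => F.mono ⟨_, hd⟩ _ _ _ _ ⟨le_rfl, hle⟩ hw, fun h => ⟨v, h, le_rfl⟩⟩

/-- Membership in `□ a` and `◇ a` is decided by the inverse images of a common set of worlds. -/
theorem exists_set_preimage (a : F.Complex) : ∃ V : Set F.World,
    (∀ u, u ∈ (F.op ⟨_, hb⟩ a).1 ↔ ∀ v ∈ V, ¬ F.rel ⟨_, hb⟩ u v) ∧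
    (∀ u, u ∈ (F.op ⟨_, hd⟩ a).1 ↔ ∃ v ∈ V, F.rel ⟨_, hd⟩ u v) := by
  cases α with
  | pos =>
    exact ⟨a.1ᶜ, fun u => ⟨fun h v hv h' => hv (h v h'), fun h v h' => not_not.1 fun hv => h v hv h'⟩,
      fun u => ⟨fun ⟨v, h, hv⟩ => ⟨v, hv, h⟩, fun ⟨v, hv, h⟩ => ⟨v, h, hv⟩⟩⟩
  | neg =>
    exact ⟨a.1, fun u => ⟨fun h v hv h' => h v h' hv, fun h v h' hv => h v hv h'⟩,
      fun u => ⟨fun ⟨v, h, hv⟩ => ⟨v, hv, h⟩, fun ⟨v, hv, h⟩ => ⟨v, h, hv⟩⟩⟩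

/-- Fix `v`, and let `X`, `Y` be the sets of worlds related to `v` by the box and the diamond
relation. Unimodality says that `X` lies in the downset, and `Y` in the upset, generated by `X ∩ Y`.
A suitable `a` has `□ a = Xᶜ` and `◇ a = Y`, and `b` ranges over all upsets; for a general `a` one
argues separately for each `v` in a set. -/
theorem mem_unimodalFrames_box_dia_iff (hL : ∀ m : L, m = ⟨_, hb⟩ ∨ m = ⟨_, hd⟩) :
    F ∈ unimodalFrames L ↔
      (∀ a b : F.Complex, F.op ⟨_, hd⟩ a ⊓ b ≤ F.op ⟨_, hb⟩ a → b ≤ F.op ⟨_, hb⟩ a) ∧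
      (∀ a b : F.Complex, F.op ⟨_, hd⟩ a ≤ F.op ⟨_, hb⟩ a ⊔ b → F.op ⟨_, hd⟩ a ≤ b) := by
  -- Both relations are closed in the same direction in the second coordinate, so `v'` can be
  -- replaced by `v`.
  have hv : ∀ u v v' u' : F.World, prodLE ⟨.box, α⟩ u' v' u v → F.rel ⟨_, hb⟩ u' v' ∧
      F.rel ⟨_, hd⟩ u' v' → u ≤ u' ∧ F.rel ⟨_, hb⟩ u' v ∧ F.rel ⟨_, hd⟩ u' v := by
    intro u v v' u' hle h
    refine ⟨by cases α <;> exact hle.1, F.mono ⟨_, hb⟩ u' v' u' v ?_ h.1,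
      F.mono ⟨_, hd⟩ u' v' u' v ?_ h.2⟩ <;> cases α <;> exact ⟨le_rfl, hle.2⟩
  have hv' : ∀ u v v' u' : F.World, prodLE ⟨.dia, α.opp⟩ u' v' u v → F.rel ⟨_, hb⟩ u' v' ∧
      F.rel ⟨_, hd⟩ u' v' → u' ≤ u ∧ F.rel ⟨_, hb⟩ u' v ∧ F.rel ⟨_, hd⟩ u' v := by
    intro u v v' u' hle h
    refine ⟨by cases α <;> exact hle.1, F.mono ⟨_, hb⟩ u' v' u' v ?_ h.1,
      F.mono ⟨_, hd⟩ u' v' u' v ?_ h.2⟩ <;> cases α <;> exact ⟨le_rfl, hle.2⟩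
  rw [mem_unimodalFrames_pair_iff hL]
  constructor
  · rintro ⟨h₁, h₂⟩
    refine ⟨fun a b hab u hu => ?_, fun a b hab u hu => ?_⟩
    · obtain ⟨V, hV, hV'⟩ := exists_set_preimage hb hd F a
      refine (hV u).2 fun v hvV huv => ?_
      obtain ⟨u', v', h, hle⟩ := h₁ u v huv
      obtain ⟨hle, h, h'⟩ := hv _ _ _ _ hle h
      exact (hV u').1 (hab ⟨(hV' u').2 ⟨v, hvV, h'⟩, b.2 hle hu⟩) v hvV h
    · obtain ⟨V, hV, hV'⟩ := exists_set_preimage hb hd F a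
      obtain ⟨v, hvV, huv⟩ := (hV' u).1 hu
      obtain ⟨u', v', h, hle⟩ := h₂ u v huv
      obtain ⟨hle, h, h'⟩ := hv' _ _ _ _ hle h
      exact b.2 hle ((hab ((hV' u').2 ⟨v, hvV, h'⟩)).resolve_left
        fun hbox => (hV u').1 hbox v hvV h)
  · rintro ⟨h₁, h₂⟩
    refine ⟨fun u v huv => ?_, fun u v huv => ?_⟩
    · obtain ⟨a, ha, ha'⟩ := exists_upset_preimage hb hd F v
      -- The largest upset that misses `X ∩ Y`.
      let b : F.Complex := ⟨{w | ¬ ∃ u', w ≤ u' ∧ F.rel ⟨_, hb⟩ u' v ∧ F.rel ⟨_, hd⟩ u' v},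
        fun _ _ hw h ⟨u', hle, h'⟩ => h ⟨u', hw.trans hle, h'⟩⟩
      by_contra hcon
      have hub : u ∈ b.1 := fun ⟨u', hle, h⟩ => hcon ⟨u', v, h, by
        cases α <;> exact ⟨hle, le_rfl⟩⟩
      refine (ha u).1 (h₁ a b (fun w hw => (ha w).2 fun h => ?_) hub) huv
      exact hw.2 ⟨w, le_rfl, h, (ha' w).1 hw.1⟩
    · obtain ⟨a, ha, ha'⟩ := exists_upset_preimage hb hd F v
      -- The least upset that contains `X ∩ Y`.
      let b : F.Complex := ⟨{w | ∃ u', u' ≤ w ∧ F.rel ⟨_, hb⟩ u' v ∧ F.rel ⟨_, hd⟩ u' v},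
        fun _ _ hw ⟨u', hle, h'⟩ => ⟨u', hle.trans hw, h'⟩⟩
      obtain ⟨u', hle, h⟩ := h₂ a b (fun w hw => by
        by_cases hbox : F.rel ⟨_, hb⟩ w v
        · exact Or.inr ⟨w, le_rfl, hbox, (ha' w).1 hw⟩
        · exact Or.inl ((ha w).2 hbox)) ((ha' u).2 huv)
      exact ⟨u', v, h, by cases α <;> exact ⟨hle, le_rfl⟩⟩

theorem isDefinableBy_quasiequation_box_dia (hL : ∀ m : L, m = ⟨_, hb⟩ ∨ m = ⟨_, hd⟩) :
    IsDefinableBy (langDLat.sum (langModal L)) IsQuasiequation (unimodalFrames.{u} L) := by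
  let a : DTerm L 2 := DTerm.var 0
  let b : DTerm L 2 := DTerm.var 1
  refine isDefinableBy_pair
    (φ := qleqn ((DTerm.op ⟨_, hd⟩ a).inf b) (DTerm.op ⟨_, hb⟩ a) b (DTerm.op ⟨_, hb⟩ a))
    (ψ := qleqn (DTerm.op ⟨_, hd⟩ a) ((DTerm.op ⟨_, hb⟩ a).sup b) (DTerm.op ⟨_, hd⟩ a) b)
    (isQuasiequation_quasieqn _ _ _ _) (isQuasiequation_quasieqn _ _ _ _) fun F => ?_
  rw [mem_unimodalFrames_box_dia_iff hb hd F hL, realize_qleqn, realize_qleqn]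
  exact and_congr forall_fin_two_fun.symm forall_fin_two_fun.symm

/-- By residuation, `◇ a ⇨ □ a` is the largest `b` allowed by the first premise and `◇ a \ □ a` the
least allowed by the second. The quasiequations need be tested only there. -/
theorem isDefinableBy_equation_box_dia (hL : ∀ m : L, m = ⟨_, hb⟩ ∨ m = ⟨_, hd⟩) :
    IsDefinableBy (langBiHA.sum (langModal L)) IsEquation (unimodalFrames.{u} L) := by
  let a : BTerm L 1 := BTerm.var 0
  refine isDefinableBy_pair
    (φ := eqn ((BTerm.op ⟨_, hd⟩ a).himp (BTerm.op ⟨_, hb⟩ a)) (BTerm.op ⟨_, hb⟩ a))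
    (ψ := eqn ((BTerm.op ⟨_, hd⟩ a).sdiff (BTerm.op ⟨_, hb⟩ a)) (BTerm.op ⟨_, hd⟩ a))
    (isEquation_eqn _ _) (isEquation_eqn _ _) fun F => ?_
  rw [mem_unimodalFrames_box_dia_iff hb hd F hL, realize_eqn, realize_eqn]
  refine and_congr ⟨fun h x => ?_, fun h a b hab => ?_⟩ ⟨fun h x => ?_, fun h a b hab => ?_⟩
  · exact le_antisymm (h (x 0) _ inf_himp_le) le_himp
  · exact (le_himp_iff'.2 hab).trans (h fun _ => a).le
  · exact le_antisymm sdiff_le (h (x 0) _ le_sup_sdiff)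
  · exact (h fun _ => a).ge.trans (sdiff_le_iff.2 hab)

end OppositePolarity

theorem isDefinableBy_of_encard_le_two {L : Set ModalSymbol} (hL : L.encard ≤ 2)
    (hpos : L ≠ {boxPos, diaPos}) (hneg : L ≠ {boxNeg, diaNeg}) :
    IsDefinableBy (langDLat.sum (langModal L)) IsQuasiequation (unimodalFrames.{u} L) ∧
    IsDefinableBy (langBiHA.sum (langModal L)) IsEquation (unimodalFrames.{u} L) := by
  have same (h : IsDefinableBy (langDLat.sum (langModal L)) IsEquation (unimodalFrames.{u} L)) :=
    And.intro h.quasiequation_of_equation h.equation_biHA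
  rcases hL.lt_or_eq with h | h
  · have hs := mem_unimodalFrames_of_subsingleton.{u}
      (Set.encard_le_one_iff_subsingleton.1 (by simpa using h))
    exact ⟨isDefinableBy_of_forall_mem hs, isDefinableBy_of_forall_mem hs⟩
  · obtain ⟨x, y, hxy, rfl⟩ := Set.encard_eq_two.1 h
    have hx : x ∈ ({x, y} : Set ModalSymbol) := Or.inl rfl
    have hy : y ∈ ({x, y} : Set ModalSymbol) := Or.inr rfl
    have h₁ : ∀ m : ({x, y} : Set ModalSymbol), m = ⟨x, hx⟩ ∨ m = ⟨y, hy⟩ := by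
      rintro ⟨m, rfl | rfl⟩ <;> simp
    have h₂ : ∀ m : ({x, y} : Set ModalSymbol), m = ⟨y, hy⟩ ∨ m = ⟨x, hx⟩ :=
      fun m => (h₁ m).symm
    have opp {α : Polarity} (hb : ⟨.box, α⟩ ∈ ({x, y} : Set ModalSymbol))
        (hd : ⟨.dia, α.opp⟩ ∈ ({x, y} : Set ModalSymbol))
        (h : ∀ m : ({x, y} : Set ModalSymbol), m = ⟨_, hb⟩ ∨ m = ⟨_, hd⟩) :=
      And.intro (isDefinableBy_quasiequation_box_dia.{u} hb hd h)
        (isDefinableBy_equation_box_dia.{u} hb hd h)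
    rcases x with ⟨_ | _, _ | _⟩ <;> rcases y with ⟨_ | _, _ | _⟩
    · exact absurd rfl hxy
    · exact same (isDefinableBy_equation_box hx hy h₁)
    · exact absurd rfl hpos
    · exact opp hx hy h₁
    · exact same (isDefinableBy_equation_box hy hx h₂)
    · exact absurd rfl hxy
    · exact opp hx hy h₁
    · exact absurd rfl hneg
    · exact absurd (Set.pair_comm _ _) hpos
    · exact opp hy hx h₂
    · exact absurd rfl hxy
    · exact same (isDefinableBy_equation_dia hx hy h₁)
    · exact opp hy hx h₂
    · exact absurd (Set.pair_comm _ _) hneg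
    · exact same (isDefinableBy_equation_dia hy hx h₂)
    · exact absurd rfl hxy

/-! ### A dense chain and its split extension -/

/-- The chain of rational numbers in an arbitrary universe. -/
abbrev Line : Type u := ULift.{u} ℚ

instance : DenselyOrdered Line.{u} :=
  ⟨fun _ _ h => let ⟨c, h₁, h₂⟩ := exists_between (ULift.down_lt.2 h)
    ⟨⟨c⟩, h₁, h₂⟩⟩

instance : NoMaxOrder Line.{u} :=
  ⟨fun a => let ⟨c, h⟩ := exists_gt a.down
    ⟨⟨c⟩, h⟩⟩

instance : NoMinOrder Line.{u} :=
  ⟨fun a => let ⟨c, h⟩ := exists_lt a.down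
    ⟨⟨c⟩, h⟩⟩

theorem Line.neg_lt_neg_iff {x y : Line.{u}} : -x < -y ↔ y < x :=
  _root_.neg_lt_neg_iff (a := x.down) (b := y.down)

theorem Line.neg_lt_comm {x y : Line.{u}} : -x < y ↔ -y < x :=
  neg_lt (a := x.down) (b := y.down)

theorem Line.lt_neg_comm {x y : Line.{u}} : x < -y ↔ y < -x :=
  lt_neg (a := x.down) (b := y.down)

/-- The chain in which each point `x` is replaced by `x⁻ < x < x⁺`. -/
abbrev Split : Type u := Line.{u} ×ₗ SignType

theorem Split.le_iff {x y : Line.{u}} {i j : SignType} :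
    (toLex (x, i) : Split) ≤ toLex (y, j) ↔ x < y ∨ x = y ∧ i ≤ j :=
  Prod.Lex.toLex_le_toLex

/-- Membership of a point of the split chain in the extension of a set. -/
def splitMem (A : Set Line.{u}) (x : Line.{u}) : SignType → Prop
  | .neg => ∃ y < x, y ∈ A
  | .zero => x ∈ A
  | .pos => ∀ y > x, y ∈ A

theorem splitMem_mono {A : Set Line.{u}} (hA : IsUpperSet A) {x y : Line.{u}} {i j : SignType}
    (hle : (toLex (x, i) : Split) ≤ toLex (y, j)) (hx : splitMem A x i) : splitMem A y j := by
  rcases Split.le_iff.1 hle with h | ⟨rfl, h⟩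
  · have hpos : ∀ z > x, z ∈ A := by
      intro z hz
      cases i with
      | zero => exact hA hz.le hx
      | neg =>
        obtain ⟨w, hw, hwA⟩ := hx
        exact hA (hw.trans hz).le hwA
      | pos => exact hx z hz
    cases j with
    | zero => exact hpos y h
    | neg =>
      -- Membership of `y⁻` needs a point strictly below `y`; density supplies one still above `x`.
      obtain ⟨z, hz, hzy⟩ := exists_between h
      exact ⟨z, hzy, hpos z hz⟩
    | pos => exact fun z hz => hpos z (h.trans hz)
  · match i, j, h, hx with
    | .neg, .neg, _, hx => exact hx
    | .zero, .zero, _, hx => exact hx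
    | .pos, .pos, _, hx => exact hx
    | .neg, .zero, _, ⟨_, hw, hwA⟩ => exact hA hw.le hwA
    | .neg, .pos, _, ⟨_, hw, hwA⟩ => exact fun y hy => hA (hw.trans hy).le hwA
    | .zero, .pos, _, hx => exact fun y hy => hA hy.le hx

theorem splitMem_subset {A B : Set Line.{u}} (h : A ⊆ B) {x : Line.{u}} {i : SignType}
    (hx : splitMem A x i) : splitMem B x i := by
  cases i with
  | zero => exact h hx
  | neg =>
    obtain ⟨y, hy, hA⟩ := hx
    exact ⟨y, hy, h hA⟩
  | pos => exact fun y hy => h (hx y hy)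

/-- The chain has no endpoints, so the quantifiers at `x⁻` and `x⁺` range over nonempty sets. -/
theorem splitMem_const {P : Prop} {x : Line.{u}} {i : SignType} :
    splitMem {_y | P} x i ↔ P := by
  cases i with
  | zero => exact Iff.rfl
  | neg => exact ⟨fun ⟨_, _, h⟩ => h, fun h => (exists_lt x).imp fun _ hy => ⟨hy, h⟩⟩
  | pos => exact ⟨fun h => (exists_gt x).elim fun y hy => h y hy, fun h _ _ => h⟩

/-- The extension of an upset of the chain to the split chain. -/
def splitUpset (A : Upset Line.{u}) : Upset Split.{u} :=
  ⟨{p | splitMem A.1 (ofLex p).1 (ofLex p).2}, fun _ _ h hp => splitMem_mono A.2 h hp⟩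

/-- The old points recover the upset from its extension, so the order is reflected as well as
preserved. -/
theorem splitUpset_le_iff {A B : Upset Line.{u}} : splitUpset A ≤ splitUpset B ↔ A ≤ B := by
  constructor
  · exact fun h x hx => h (a := toLex (x, SignType.zero)) hx
  · rintro h ⟨x, i⟩ hx
    exact splitMem_subset h hx

theorem splitUpset_top : splitUpset (⊤ : Upset Line.{u}) = ⊤ :=
  top_unique fun _ _ => splitMem_const.2 trivial

theorem splitUpset_bot : splitUpset (⊥ : Upset Line.{u}) = ⊥ :=
  bot_unique fun _ h => splitMem_const.1 h

/-! ### Bi-Heyting operations on a chain of upsets -/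

theorem Upset.le_total {W : Type u} [LinearOrder W] (a b : Upset W) : a ≤ b ∨ b ≤ a :=
  a.2.total b.2

/-- In a chain `a ⇨ b` is either `⊤` or `b`, and dually for `a \ b`. An order embedding of such
chains that preserves the bounds therefore preserves both operations. -/
theorem himp_eq_of_not_le {A : Type*} [BiheytingAlgebra A] (htot : ∀ a b : A, a ≤ b ∨ b ≤ a)
    {a b : A} (h : ¬ a ≤ b) : a ⇨ b = b := by
  refine le_antisymm ?_ le_himp
  rcases htot a (a ⇨ b) with h' | h'
  · exact absurd ((le_inf h' le_rfl).trans himp_inf_le) h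
  · exact (le_inf le_rfl h').trans himp_inf_le

theorem sdiff_eq_of_not_le {A : Type*} [BiheytingAlgebra A] (htot : ∀ a b : A, a ≤ b ∨ b ≤ a)
    {a b : A} (h : ¬ a ≤ b) : a \ b = a := by
  refine le_antisymm sdiff_le ?_
  rcases htot (a \ b) b with h' | h'
  · exact absurd (le_sup_sdiff.trans (sup_le le_rfl h')) h
  · exact le_sup_sdiff.trans (sup_le h' le_rfl)

theorem splitUpset_inf (a b : Upset Line.{u}) :
    splitUpset (a ⊓ b) = splitUpset a ⊓ splitUpset b := by
  rcases Upset.le_total a b with h | h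
  · rw [inf_eq_left.2 h, inf_eq_left.2 (splitUpset_le_iff.2 h)]
  · rw [inf_eq_right.2 h, inf_eq_right.2 (splitUpset_le_iff.2 h)]

theorem splitUpset_sup (a b : Upset Line.{u}) :
    splitUpset (a ⊔ b) = splitUpset a ⊔ splitUpset b := by
  rcases Upset.le_total a b with h | h
  · rw [sup_eq_right.2 h, sup_eq_right.2 (splitUpset_le_iff.2 h)]
  · rw [sup_eq_left.2 h, sup_eq_left.2 (splitUpset_le_iff.2 h)]

theorem splitUpset_himp (a b : Upset Line.{u}) :
    splitUpset (a ⇨ b) = splitUpset a ⇨ splitUpset b := by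
  by_cases h : a ≤ b
  · rw [himp_eq_top_iff.2 h, himp_eq_top_iff.2 (splitUpset_le_iff.2 h), splitUpset_top]
  · rw [himp_eq_of_not_le Upset.le_total h,
      himp_eq_of_not_le Upset.le_total (mt splitUpset_le_iff.1 h)]

theorem splitUpset_sdiff (a b : Upset Line.{u}) :
    splitUpset (a \ b) = splitUpset a \ splitUpset b := by
  by_cases h : a ≤ b
  · rw [sdiff_eq_bot_iff.2 h, sdiff_eq_bot_iff.2 (splitUpset_le_iff.2 h), splitUpset_bot]
  · rw [sdiff_eq_of_not_le Upset.le_total h,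
      sdiff_eq_of_not_le Upset.le_total (mt splitUpset_le_iff.1 h)]

/-! ### Modal operators of generated relations -/

section Gen

variable {W : Type u} [PartialOrder W] {R : W → W → Prop} {a : Set W}

theorem mem_modalSet_gen_boxPos (ha : IsUpperSet a) (u : W) :
    u ∈ modalSet boxPos (gen boxPos R) a ↔ ∀ u' ≥ u, ∀ v, R u' v → v ∈ a :=
  ⟨fun h u' hu v hR => h v ((gen_iff _ _ _ _).2 ⟨u', v, hR, hu, le_rfl⟩), fun h v hv => by
    obtain ⟨u', v', hR, hu, hv'⟩ := (gen_iff _ _ _ _).1 hv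
    exact ha hv' (h u' hu v' hR)⟩

theorem mem_modalSet_gen_boxNeg (ha : IsUpperSet a) (u : W) :
    u ∈ modalSet boxNeg (gen boxNeg R) a ↔ ∀ u' ≥ u, ∀ v, R u' v → v ∉ a :=
  ⟨fun h u' hu v hR => h v ((gen_iff _ _ _ _).2 ⟨u', v, hR, hu, le_rfl⟩), fun h v hv => by
    obtain ⟨u', v', hR, hu, hv'⟩ := (gen_iff _ _ _ _).1 hv
    exact fun hva => h u' hu v' hR (ha hv' hva)⟩

theorem mem_modalSet_gen_diaPos (ha : IsUpperSet a) (u : W) :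
    u ∈ modalSet diaPos (gen diaPos R) a ↔ ∃ u' ≤ u, ∃ v, R u' v ∧ v ∈ a :=
  ⟨fun ⟨v, hv, hva⟩ => by
    obtain ⟨u', v', hR, hu, hv'⟩ := (gen_iff _ _ _ _).1 hv
    exact ⟨u', hu, v', hR, ha hv' hva⟩,
  fun ⟨u', hu, v, hR, hv⟩ => ⟨v, (gen_iff _ _ _ _).2 ⟨u', v, hR, hu, le_rfl⟩, hv⟩⟩

theorem mem_modalSet_gen_diaNeg (ha : IsUpperSet a) (u : W) :
    u ∈ modalSet diaNeg (gen diaNeg R) a ↔ ∃ u' ≤ u, ∃ v, R u' v ∧ v ∉ a :=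
  ⟨fun ⟨v, hv, hva⟩ => by
    obtain ⟨u', v', hR, hu, hv'⟩ := (gen_iff _ _ _ _).1 hv
    exact ⟨u', hu, v', hR, fun h => hva (ha hv' h)⟩,
  fun ⟨u', hu, v, hR, hv⟩ => ⟨v, (gen_iff _ _ _ _).2 ⟨u', v, hR, hu, le_rfl⟩, hv⟩⟩

end Gen

/-! ### The frames on the chain and on the split chain -/

/-- The relations on the chain: strict comparison for the symbols of polarity `α`, the total
relation for the others. The second argument is reflected if `α = -`. -/
def lineRel : Polarity → ModalSymbol → Line.{u} → Line.{u} → Prop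
  | .pos, ⟨.box, .pos⟩, x, y => x < y
  | .pos, ⟨.dia, .pos⟩, x, y => y < x
  | .neg, ⟨.box, .neg⟩, x, y => x < -y
  | .neg, ⟨.dia, .neg⟩, x, y => -y < x
  | _, _, _, _ => True

theorem isMonotoneRel_lineRel (α : Polarity) (m : ModalSymbol) :
    IsMonotoneRel m (lineRel.{u} α m) := by
  rintro u v u' v' h hR
  rcases α with _ | _ <;> rcases m with ⟨_ | _, _ | _⟩ <;> try trivial
  · exact (h.1.trans_lt hR).trans_le h.2
  · exact (h.2.trans_lt hR).trans_le h.1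
  · exact Line.lt_neg_comm.1 (h.2.trans_lt (Line.lt_neg_comm.1 (h.1.trans_lt hR)))
  · exact (Line.neg_lt_comm.1 ((Line.neg_lt_comm.1 hR).trans_le h.2)).trans_le h.1

/-- The modal frame on the chain. -/
def lineFrame (α : Polarity) (L : Set ModalSymbol) : ModalFrame.{u} L where
  World := Line.{u}
  rel m := lineRel α m.1
  mono m := isMonotoneRel_lineRel α m.1

/-- The reflection of the split chain if `α = -`, the identity if `α = +`. -/
def splitReflect : Polarity → Split.{u} → Split.{u}
  | .pos, p => p
  | .neg, p => toLex (-(ofLex p).1, -(ofLex p).2)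

/-- The generating relation on the split chain relates each new point to its reflection. -/
def splitGen (α : Polarity) (p q : Split.{u}) : Prop := (ofLex p).2 ≠ 0 ∧ q = splitReflect α p

/-- The unimodal frame on the split chain. -/
def splitFrame (α : Polarity) (L : Set ModalSymbol) : ModalFrame.{u} L where
  World := Split.{u}
  rel m := gen m.1 (splitGen α)
  mono m := (gen_isLeast m.1 (splitGen α)).1.1

theorem splitFrame_mem (α : Polarity) (L : Set ModalSymbol) :
    splitFrame.{u} α L ∈ unimodalFrames L := ⟨splitGen α, fun _ => rfl⟩

/-- A common pair would satisfy both `u < v` and `v < u`, while the box relation is not empty. -/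
theorem lineFrame_pos_notMem {L : Set ModalSymbol} (hb : boxPos ∈ L) (hd : diaPos ∈ L) :
    lineFrame.{u} .pos L ∉ unimodalFrames L := by
  intro h
  obtain ⟨u, v, h, -⟩ := mem_unimodalFrames_iff.1 h ⟨boxPos, hb⟩ (⟨0⟩ : Line) (⟨1⟩ : Line)
    (zero_lt_one (α := ℚ))
  exact lt_asymm (α := Line) (h ⟨boxPos, hb⟩) (h ⟨diaPos, hd⟩)

theorem lineFrame_neg_notMem {L : Set ModalSymbol} (hb : boxNeg ∈ L) (hd : diaNeg ∈ L) :
    lineFrame.{u} .neg L ∉ unimodalFrames L := by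
  intro h
  obtain ⟨u, v, h, -⟩ := mem_unimodalFrames_iff.1 h ⟨boxNeg, hb⟩ (⟨0⟩ : Line) (⟨-1⟩ : Line)
    (show (0 : ℚ) < - -1 by norm_num)
  exact lt_asymm (α := Line) (h ⟨boxNeg, hb⟩) (h ⟨diaNeg, hd⟩)

/-! ### Modal operators under the extension of upsets -/

/-- The least new point of the split chain above a given point. -/
def ceilSign : SignType → SignType
  | .neg => .neg
  | _ => .pos

/-- The greatest new point of the split chain below a given point. -/
def floorSign : SignType → SignType
  | .pos => .pos
  | _ => .neg

/-- Reflection exchanges `x⁻` and `x⁺`, while complementation exchanges the quantifiers `∃` and `∀`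
that define membership there. The two effects cancel. -/
theorem not_splitMem_reflect {A : Set Line.{u}} {x : Line.{u}} {i : SignType} :
    ¬ splitMem A (-x) (-i) ↔ splitMem {y | -y ∉ A} x i := by
  cases i with
  | zero => exact Iff.rfl
  | neg =>
    change ¬ (∀ y > -x, y ∈ A) ↔ ∃ y < x, -y ∉ A
    push Not
    exact ⟨fun ⟨y, hy, h⟩ => ⟨-y, Line.neg_lt_comm.1 hy, by rwa [neg_neg]⟩,
      fun ⟨y, hy, h⟩ => ⟨-y, Line.neg_lt_neg_iff.2 hy, h⟩⟩
  | pos =>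
    change ¬ (∃ y < -x, y ∈ A) ↔ ∀ y > x, -y ∉ A
    push Not
    exact ⟨fun h y hy => h (-y) (Line.neg_lt_neg_iff.2 hy),
      fun h y hy => by simpa using h (-y) (Line.lt_neg_comm.1 hy)⟩

/-- The new points above a given point have a least element, and an upward closed property holds at
all of them iff it holds there. -/
theorem forall_ge_ne_zero_iff {Q : Split.{u} → Prop} (hQ : ∀ p q, p ≤ q → Q p → Q q)
    (x : Line.{u}) (i : SignType) :
    (∀ p ≥ (toLex (x, i) : Split), (ofLex p).2 ≠ 0 → Q p) ↔ Q (toLex (x, ceilSign i)) := by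
  constructor
  · exact fun h => h _ (Split.le_iff.2 (Or.inr ⟨rfl, by cases i <;> decide⟩))
      (by cases i <;> simp [ceilSign])
  · rintro h ⟨y, j⟩ hp hj
    refine hQ _ _ (Split.le_iff.2 ?_) h
    refine (Split.le_iff.1 hp).imp_right fun ⟨h, h'⟩ => ⟨h, ?_⟩
    change j ≠ 0 at hj
    revert hj h'
    cases i <;> cases j <;> decide

theorem exists_le_ne_zero_iff {Q : Split.{u} → Prop} (hQ : ∀ p q, p ≤ q → Q p → Q q)
    (x : Line.{u}) (i : SignType) :
    (∃ p ≤ (toLex (x, i) : Split), (ofLex p).2 ≠ 0 ∧ Q p) ↔ Q (toLex (x, floorSign i)) := by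
  constructor
  · rintro ⟨⟨y, j⟩, hp, hj, h⟩
    refine hQ _ _ (Split.le_iff.2 ?_) h
    refine (Split.le_iff.1 hp).imp_right fun ⟨h, h'⟩ => ⟨h, ?_⟩
    change j ≠ 0 at hj
    revert hj h'
    cases i <;> cases j <;> decide
  · exact fun h => ⟨_, Split.le_iff.2 (Or.inr ⟨rfl, by cases i <;> decide⟩),
      by cases i <;> simp [floorSign], h⟩

section Operators

variable {B : Set Line.{u}}

/-- At an old point `x` the least new point above is `x⁺`, whose membership is by definition the
condition that `<` imposes on `□₊`. A new point is its own least one, and density makes the extra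
strict inequality harmless. -/
theorem splitMem_strict_box (hB : IsUpperSet B) (x : Line.{u}) (i : SignType) :
    splitMem {z | ∀ y, z < y → y ∈ B} x i ↔
    ∀ p ≥ (toLex (x, i) : Split), (ofLex p).2 ≠ 0 → splitMem B (ofLex p).1 (ofLex p).2 := by
  rw [forall_ge_ne_zero_iff (Q := fun p => splitMem B (ofLex p).1 (ofLex p).2)
    fun p q h => splitMem_mono hB h]
  cases i with
  | zero => exact Iff.rfl
  | neg =>
    constructor
    · rintro ⟨y, hy, h⟩
      obtain ⟨z, hyz, hzx⟩ := exists_between hy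
      exact ⟨z, hzx, h z hyz⟩
    · rintro ⟨y, hy, h⟩
      exact ⟨y, hy, fun z hz => hB hz.le h⟩
  | pos =>
    constructor
    · intro h y hy
      obtain ⟨z, hxz, hzy⟩ := exists_between hy
      exact h z hxz y hzy
    · exact fun h y hy z hz => h z (lt_trans hy hz)

/-- Dual to the box case: at `x` the greatest new point below is `x⁻`, whose membership is the
condition for `◇₊` and `>`. -/
theorem splitMem_strict_dia (hB : IsUpperSet B) (x : Line.{u}) (i : SignType) :
    splitMem {z | ∃ y, y < z ∧ y ∈ B} x i ↔
    ∃ p ≤ (toLex (x, i) : Split), (ofLex p).2 ≠ 0 ∧ splitMem B (ofLex p).1 (ofLex p).2 := by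
  rw [exists_le_ne_zero_iff (Q := fun p => splitMem B (ofLex p).1 (ofLex p).2)
    fun p q h => splitMem_mono hB h]
  cases i with
  | zero => exact Iff.rfl
  | neg =>
    constructor
    · rintro ⟨y, hy, z, hzy, h⟩
      exact ⟨z, hzy.trans hy, h⟩
    · rintro ⟨y, hy, h⟩
      obtain ⟨z, hyz, hzx⟩ := exists_between hy
      exact ⟨z, hzx, y, hyz, h⟩
  | pos =>
    constructor
    · intro h y hy
      obtain ⟨z, hzy, hz⟩ := h y hy
      exact hB hzy.le hz
    · intro h y hy
      obtain ⟨z, hxz, hzy⟩ := exists_between hy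
      exact ⟨z, hzy, h z hxz⟩

/-- Both sides say that `B` is empty: as there is no maximum, a nonempty `B` captures a new point
above any given one. -/
theorem splitMem_total_box (hB : IsUpperSet B) (x : Line.{u}) (i : SignType) :
    splitMem {_z | ∀ y, y ∉ B} x i ↔
    ∀ p ≥ (toLex (x, i) : Split), (ofLex p).2 ≠ 0 → ¬ splitMem B (ofLex p).1 (ofLex p).2 := by
  rw [splitMem_const]
  constructor
  · exact fun h p _ _ hp => splitMem_const.1 (splitMem_subset (B := {_y | False}) h hp)
  · intro h y hy
    obtain ⟨w, hw⟩ := exists_gt (max x y)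
    rw [max_lt_iff] at hw
    exact h (toLex (w, SignType.pos)) (Split.le_iff.2 (Or.inl hw.1)) (by simp)
      fun z hz => hB (hw.2.trans hz).le hy

/-- Both sides say that `B` is not everything: as there is no minimum, a missing point `y` yields a
missing new point below both `x` and `y`. -/
theorem splitMem_total_dia (x : Line.{u}) (i : SignType) :
    splitMem {_z | ∃ y, y ∉ B} x i ↔
    ∃ p ≤ (toLex (x, i) : Split), (ofLex p).2 ≠ 0 ∧ ¬ splitMem B (ofLex p).1 (ofLex p).2 := by
  rw [splitMem_const]
  constructor
  · rintro ⟨y, hy⟩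
    obtain ⟨w, hw⟩ := exists_lt (min x y)
    rw [lt_min_iff] at hw
    exact ⟨toLex (w, SignType.pos), Split.le_iff.2 (Or.inl hw.1), by simp, fun h => hy (h y hw.2)⟩
  · rintro ⟨p, -, -, hp⟩
    by_contra! h
    exact hp (splitMem_subset (A := {_y | True}) (fun y _ => h y) (splitMem_const.2 trivial))

end Operators

theorem isUpperSet_reflect {A : Set Line.{u}} (hA : IsUpperSet A) :
    IsUpperSet {y : Line.{u} | -y ∉ A} :=
  fun x y h hx hy => hx (hA (neg_le_neg (a := x.down) (b := y.down) h) hy)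

theorem forall_splitGen_iff {α : Polarity} {p : Split.{u}} {P : Split.{u} → Prop} :
    (∀ p' ≥ p, ∀ q, splitGen α p' q → P q) ↔
      ∀ p' ≥ p, (ofLex p').2 ≠ 0 → P (splitReflect α p') :=
  ⟨fun h p' hp h0 => h p' hp _ ⟨h0, rfl⟩, fun h p' hp _ ⟨h0, hq⟩ => hq ▸ h p' hp h0⟩

theorem exists_splitGen_iff {α : Polarity} {p : Split.{u}} {P : Split.{u} → Prop} :
    (∃ p' ≤ p, ∃ q, splitGen α p' q ∧ P q) ↔
      ∃ p' ≤ p, (ofLex p').2 ≠ 0 ∧ P (splitReflect α p') :=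
  ⟨fun ⟨p', hp, _, ⟨h0, hq⟩, h⟩ => ⟨p', hp, h0, hq ▸ h⟩,
    fun ⟨p', hp, h0, h⟩ => ⟨p', hp, _, ⟨h0, rfl⟩, h⟩⟩

/-- Symbols of polarity `α` fall under the strict comparisons, the others under the total relation.
For `α = -` the set `A` is replaced by the upset `{y | -y ∉ A}`, which turns negative symbols into
positive ones and conversely. -/
theorem splitMem_lineRel (α : Polarity) (m : ModalSymbol) (A : Upset Line.{u}) (x : Line.{u})
    (i : SignType) : splitMem (modalSet m (lineRel α m) A.1) x i ↔
      (toLex (x, i) : Split) ∈ modalSet m (gen m (splitGen α)) (splitUpset A).1 := by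
  have hB := isUpperSet_reflect A.2
  have hnotMem : ∀ p : Split.{u}, splitReflect .neg p ∉ (splitUpset A).1 ↔
      splitMem {y | -y ∉ A.1} (ofLex p).1 (ofLex p).2 := fun p => not_splitMem_reflect
  have hmem : ∀ p : Split.{u}, splitReflect .neg p ∈ (splitUpset A).1 ↔
      ¬ splitMem {y | -y ∉ A.1} (ofLex p).1 (ofLex p).2 := fun p => by
    rw [← hnotMem, not_not]
  have e := (splitUpset A).2
  rcases m with ⟨_ | _, _ | _⟩
  · refine Iff.trans ?_ ((mem_modalSet_gen_boxPos e _).trans forall_splitGen_iff).symm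
    cases α
    · exact splitMem_strict_box A.2 x i
    · simp only [hmem]
      rw [← splitMem_total_box hB]
      change splitMem {_z | ∀ y, True → y ∈ A.1} x i ↔ _
      rw [splitMem_const, splitMem_const]
      refine ⟨fun h y hy => hy (h (-y) trivial), fun h y _ => ?_⟩
      simpa only [Set.mem_ofPred_eq, neg_neg, not_not] using h (-y)
  · refine Iff.trans ?_ ((mem_modalSet_gen_boxNeg e _).trans forall_splitGen_iff).symm
    cases α
    · refine Iff.trans ?_ (splitMem_total_box A.2 x i)
      change splitMem {_z | ∀ y, True → y ∉ A.1} x i ↔ _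
      rw [splitMem_const, splitMem_const]
      exact ⟨fun h y => h y trivial, fun h y _ => h y⟩
    · simp only [hnotMem]
      rw [← splitMem_strict_box hB]
      change splitMem {z | ∀ y, z < -y → y ∉ A.1} x i ↔ _
      -- Substituting `-y` for `y` moves the reflection from the relation to the set.
      have hset : {z : Line.{u} | ∀ y, z < -y → y ∉ A.1} = {z | ∀ y, z < y → -y ∉ A.1} :=
        Set.ext fun z => (Equiv.neg Line.{u}).forall_congr fun {y} =>
          show (z < -y → y ∉ A.1) ↔ (z < -y → - -y ∉ A.1) by rw [neg_neg]
      rw [hset]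
      exact Iff.rfl
  · refine Iff.trans ?_ ((mem_modalSet_gen_diaPos e _).trans exists_splitGen_iff).symm
    cases α
    · exact splitMem_strict_dia A.2 x i
    · simp only [hmem]
      rw [← splitMem_total_dia]
      change splitMem {_z | ∃ y, True ∧ y ∈ A.1} x i ↔ _
      rw [splitMem_const, splitMem_const]
      refine ⟨fun ⟨y, _, hy⟩ => ⟨-y, fun h => h ?_⟩,
        fun ⟨y, hy⟩ => ⟨-y, trivial, not_not.1 hy⟩⟩
      rwa [neg_neg]
  · refine Iff.trans ?_ ((mem_modalSet_gen_diaNeg e _).trans exists_splitGen_iff).symm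
    cases α
    · refine Iff.trans ?_ (splitMem_total_dia x i)
      change splitMem {_z | ∃ y, True ∧ y ∉ A.1} x i ↔ _
      rw [splitMem_const, splitMem_const]
      exact ⟨fun ⟨y, _, hy⟩ => ⟨y, hy⟩, fun ⟨y, hy⟩ => ⟨y, trivial, hy⟩⟩
    · simp only [hnotMem]
      rw [← splitMem_strict_dia hB]
      change splitMem {z | ∃ y, -y < z ∧ y ∉ A.1} x i ↔ _
      have hset : {z : Line.{u} | ∃ y, -y < z ∧ y ∉ A.1} = {z | ∃ y, y < z ∧ -y ∉ A.1} :=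
        Set.ext fun z => (Equiv.neg Line.{u}).exists_congr fun y =>
          show (-y < z ∧ y ∉ A.1) ↔ (-y < z ∧ - -y ∉ A.1) by rw [neg_neg]
      rw [hset]
      exact Iff.rfl

theorem splitUpset_op (α : Polarity) (L : Set ModalSymbol) (m : L) (A : Upset Line.{u}) :
    splitUpset ((lineFrame.{u} α L).op m A) = (splitFrame.{u} α L).op m (splitUpset A) :=
  Subtype.ext (Set.ext fun p => splitMem_lineRel α m.1 A (ofLex p).1 (ofLex p).2)

/-- The complex algebra of the frame on the chain embeds in that of the frame on the split
chain. -/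
def splitEmbedding (α : Polarity) (L : Set ModalSymbol) :
    (lineFrame.{u} α L).Complex ↪[langBiHA.sum (langModal L)] (splitFrame.{u} α L).Complex where
  toFun := splitUpset
  inj' a b h := le_antisymm (splitUpset_le_iff.1 h.le) (splitUpset_le_iff.1 h.ge)
  map_fun' {n} f x := by
    rcases f with f | f <;> cases f
    · exact splitUpset_inf (x 0) (x 1)
    · exact splitUpset_sup (x 0) (x 1)
    · exact splitUpset_top
    · exact splitUpset_bot
    · exact splitUpset_himp (x 0) (x 1)
    · exact splitUpset_sdiff (x 0) (x 1)
    · exact splitUpset_op α L _ (x 0)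
  map_rel' {n} r := by rcases r with r | r <;> cases r

theorem not_isDefinableBy_universal_pos {L : Set ModalSymbol} (hb : boxPos ∈ L)
    (hd : diaPos ∈ L) : ¬ IsDefinableBy (langBiHA.sum (langModal L)) IsUniversalSentence
      (unimodalFrames.{u} L) :=
  not_isDefinableBy_of_embedding (lineFrame_pos_notMem hb hd) (splitFrame_mem .pos L)
    (splitEmbedding .pos L)

theorem not_isDefinableBy_universal_neg {L : Set ModalSymbol} (hb : boxNeg ∈ L)
    (hd : diaNeg ∈ L) : ¬ IsDefinableBy (langBiHA.sum (langModal L)) IsUniversalSentence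
      (unimodalFrames.{u} L) :=
  not_isDefinableBy_of_embedding (lineFrame_neg_notMem hb hd) (splitFrame_mem .neg L)
    (splitEmbedding .neg L)

/-- A set of modal symbols that contains neither `□₊, ◇₊` nor `□₋, ◇₋` has at most two elements. -/
theorem encard_le_two {L : Set ModalSymbol} (hpos : ¬ (boxPos ∈ L ∧ diaPos ∈ L))
    (hneg : ¬ (boxNeg ∈ L ∧ diaNeg ∈ L)) : L.encard ≤ 2 := by
  -- Two different symbols of one polarity would form an excluded pair, so polarity is injective on
  -- `L`.
  have hinj : Set.InjOn (fun m : ModalSymbol => m.pol) L := by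
    rintro ⟨s, p⟩ hx ⟨t, q⟩ hy h
    obtain rfl : p = q := h
    cases p <;> cases s <;> cases t
    · rfl
    · exact absurd ⟨hx, hy⟩ hpos
    · exact absurd ⟨hy, hx⟩ hpos
    · rfl
    · rfl
    · exact absurd ⟨hx, hy⟩ hneg
    · exact absurd ⟨hy, hx⟩ hneg
    · rfl
  have hsub : (fun m : ModalSymbol => m.pol) '' L ⊆ {Polarity.pos, Polarity.neg} := by
    rintro (_ | _) _ <;> simp
  exact hinj.encard_image ▸ (Set.encard_le_encard hsub).trans (Set.encard_pair (by simp)).le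

end Unimodal

/-! ### The equivalence -/

theorem mainTheorem3 (L : Set Unimodal.ModalSymbol) :
    List.TFAE [
      Unimodal.IsDefinableBy (Unimodal.langDLat.sum (Unimodal.langModal L))
        Unimodal.IsQuasiequation (Unimodal.unimodalFrames.{u} L),
      Unimodal.IsDefinableBy (Unimodal.langDLat.sum (Unimodal.langModal L))
        Unimodal.IsUniversalSentence (Unimodal.unimodalFrames.{u} L),
      Unimodal.IsDefinableBy (Unimodal.langBiHA.sum (Unimodal.langModal L))
        Unimodal.IsEquation (Unimodal.unimodalFrames.{u} L),
      Unimodal.IsDefinableBy (Unimodal.langBiHA.sum (Unimodal.langModal L))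
        Unimodal.IsUniversalSentence (Unimodal.unimodalFrames.{u} L),
      L.encard ≤ 2 ∧ L ≠ {Unimodal.boxPos, Unimodal.diaPos} ∧
        L ≠ {Unimodal.boxNeg, Unimodal.diaNeg}] := by
  tfae_have 1 → 2 := fun h => h.mono fun _ => Unimodal.IsQuasiequation.isUniversalSentence
  tfae_have 2 → 4 := fun h => h.universal_biHA
  tfae_have 3 → 4 := fun h => h.mono fun _ => Unimodal.IsEquation.isUniversalSentence
  tfae_have 5 → 1 := fun ⟨h, hpos, hneg⟩ =>
    (Unimodal.isDefinableBy_of_encard_le_two h hpos hneg).1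
  tfae_have 5 → 3 := fun ⟨h, hpos, hneg⟩ =>
    (Unimodal.isDefinableBy_of_encard_le_two h hpos hneg).2
  -- The counterexamples apply whenever `L` contains an excluded pair, not only when it equals one;
  -- this also forces the bound on its size.
  tfae_have 4 → 5 := by
    intro h
    have hpos : ¬ (Unimodal.boxPos ∈ L ∧ Unimodal.diaPos ∈ L) :=
      fun hL => Unimodal.not_isDefinableBy_universal_pos hL.1 hL.2 h
    have hneg : ¬ (Unimodal.boxNeg ∈ L ∧ Unimodal.diaNeg ∈ L) :=
      fun hL => Unimodal.not_isDefinableBy_universal_neg hL.1 hL.2 h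
    exact ⟨Unimodal.encard_le_two hpos hneg, fun hL => hpos (by simp [hL]),
      fun hL => hneg (by simp [hL])⟩
  tfae_finish
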